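/- Let $0<r<\pi/2$, and let $v_1,v_2,w_1,w_2$ be points of the unit sphere $\mathbb S^2\subset\mathbb R^3$ such that the eight points $\pm v_1,\pm v_2,\pm w_1,\pm w_2$ are distinct. For a point $c\in\mathbb S^2$ let $C_c$ be the circle of spherical radius $r$ centered at $c$. Let $\mu_1$ be the uniform distribution on $C_{v_1}\cup C_{-v_1}\cup C_{v_2}\cup C_{-v_2}$, and let $\mu_2$ be the uniform distribution on $C_{w_1}\cup C_{-w_1}\cup C_{w_2}\cup C_{-w_2}$. The crossing graph of a geodesic drawing of a complete bipartite graph on $\mathbb S^2$ has the edges of the drawing as its vertices, two of them being adjacent if they cross. For finite graphs $H,X$ let $t(H,X)=\hom(H,X)/|V(X)|^{|V(H)|}$. For a graphon $W$ (a symmetric measurable function $[0,1]^2\to[0,1]$) and a graph $H$ on $\{1,\dots,k\}$ let $t(H,W)=\int_{[0,1]^k}\prod_{ij\in E(H)}W(x_i,x_j)\,dx$. A sequence $(X_n)$ of graphs converges to $W$ if $t(H,X_n)\to t(H,W)$ for every finite graph $H$. A graphon $W$ is called a crossing graphon of $(\mu_1,\mu_2)$, written $W=W(\mu_1,\mu_2)$,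 if the following holds with probability $1$, whatever the dependence between different $n$: the crossing graphs of random geodesic drawings $D_n$ of $K_{n,n}$ converge to $W$, where for each $n$ the two parts of $D_n$ consist of $n$ points with law $\mu_1$ and $n$ points with law $\mu_2$, all $2n$ points being independent. For each $n$ let $D_4^{(n)}$ be a blowup drawing of $K_{4n,4n}$: its parts consist of $n$ evenly spaced points on each of the four circles $C_{\pm v_1},C_{\pm v_2}$, and of $n$ evenly spaced points on each of the four circles $C_{\pm w_1},C_{\pm w_2}$, respectively. The rotation of the points on each circle is arbitrary, except that no two of the $8n$ points are antipodal and no three of them lie on a common great circle. Each point of the first part is joined to each point of the second part by a geodesic segment. Then a crossing graphon $W(\mu_1,\mu_2)$ exists. For every such graphon $W(\mu_1,\mu_2)$ and every such sequence of blowup drawings, the crossing graphs of $D_4^{(n)}$ converge as $n\to\infty$, and their limit is $W(\mu_1,\mu_2)$. -/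

import Mathlib

open MeasureTheory Filter Topology
open scoped unitInterval ENNReal

noncomputable section

/-- Euclidean three-space. -/
abbrev E3 : Type := EuclideanSpace ℝ (Fin 3)

/-- The unit sphere in three-space. -/
abbrev S2 : Type := Metric.sphere (0 : E3) 1

/-! ### Geodesic drawings and crossing graphs -/

/-- The relative interior of the geodesic segment joining two non-antipodal points `x`, `y` of the
sphere: the points of the sphere that are positive combinations of `x` and `y`. -/
def openArc (x y : S2) : Set S2 :=
  {z | ∃ s t : ℝ, 0 < s ∧ 0 < t ∧ (z : E3) = s • (x : E3) + t • (y : E3)}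

/-- The crossing graph of the geodesic drawing of the complete bipartite graph whose two parts are
placed at the points `a i` and `b j`: its vertices are the edges `(i, j)` of the drawing, and two
of them are adjacent if they are different and cross (at a point interior to both). -/
def crossingGraph {ι κ : Type} (a : ι → S2) (b : κ → S2) : SimpleGraph (ι × κ) where
  Adj e f := e ≠ f ∧ (openArc (a e.1) (b e.2) ∩ openArc (a f.1) (b f.2)).Nonempty
  symm := ⟨fun _ _ h => ⟨h.1.symm, by rw [Set.inter_comm]; exact h.2⟩⟩
  loopless := ⟨fun _ h => h.1 rfl⟩

/-- No two of the points are antipodal, and no three of them lie on a common great circle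
(that is, on a common plane through the origin). -/
def GeneralPosition {ι : Type} (p : ι → S2) : Prop :=
  (∀ i j, p i ≠ -p j) ∧
    ∀ i j k, i ≠ j → i ≠ k → j ≠ k →
      LinearIndependent ℝ ![(p i : E3), (p j : E3), (p k : E3)]

/-! ### Graph limits -/

/-- The homomorphism density `t(H, G) = hom(H, G) / |G| ^ |H|`. -/
def homDensity {k : ℕ} (H : SimpleGraph (Fin k)) {V : Type} (G : SimpleGraph V) : ℝ :=
  (Nat.card (H →g G) : ℝ) / (Nat.card V : ℝ) ^ k

/-- A graphon: a symmetric measurable function from the unit square to `[0, 1]`. -/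
structure Graphon where
  toFun : I → I → ℝ
  measurable : Measurable (Function.uncurry toFun)
  symm : ∀ x y, toFun x y = toFun y x
  nonneg : ∀ x y, 0 ≤ toFun x y
  le_one : ∀ x y, toFun x y ≤ 1

open scoped Classical in
/-- The homomorphism density `t(H, W)`, the integral over `[0, 1] ^ k` of the product of the
`W (x i) (x j)` over all edges `ij` of `H` (each edge taken once). -/
def Graphon.homDensity (W : Graphon) {k : ℕ} (H : SimpleGraph (Fin k)) : ℝ :=
  ∫ x : Fin k → I, ∏ e : Fin k × Fin k with e.1 < e.2 ∧ H.Adj e.1 e.2, W.toFun (x e.1) (x e.2)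

/-- The sequence of graphs `X n` is convergent with limit `W`: for every finite graph `H`, the
densities `t(H, X n)` converge to `t(H, W)`. -/
def ConvergesToGraphon {V : ℕ → Type} (X : ∀ n, SimpleGraph (V n)) (W : Graphon) : Prop :=
  ∀ (k : ℕ) (H : SimpleGraph (Fin k)),
    Tendsto (fun n => homDensity H (X n)) atTop (𝓝 (W.homDensity H))

/-- `W` is the crossing graphon `W(μ₁, μ₂)`: whenever, for each `n`, the parts of a geodesic
drawing of `K_{n,n}` consist of `n` independent `μ₁`-random points and `n` independent `μ₂`-random
points, all `2n` points being independent, then with probability `1` the crossing graphs of these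
drawings converge to `W`. Nothing is assumed on the dependence between different `n`. -/
def IsCrossingGraphon (μ₁ μ₂ : Measure S2) (W : Graphon) : Prop :=
  ∀ (Ω : Type) [MeasurableSpace Ω] (P : Measure Ω) [IsProbabilityMeasure P]
    (A B : ∀ n : ℕ, Ω → Fin n → S2),
    (∀ n, ProbabilityTheory.HasLaw (fun ω => (A n ω, B n ω))
      ((Measure.pi fun _ => μ₁).prod (Measure.pi fun _ => μ₂)) P) →
    ∀ᵐ ω ∂P, ConvergesToGraphon (fun n => crossingGraph (A n ω) (B n ω)) W

/-! ### Circles on the sphere -/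

/-- The point at angle `θ` of the circle of spherical radius `r` centred at `b 0`. -/
def circlePoint (b : OrthonormalBasis (Fin 3) ℝ E3) (r θ : ℝ) : S2 :=
  ⟨Real.cos r • b 0 + Real.sin r • (Real.cos θ • b 1 + Real.sin θ • b 2), by
    have h0 : inner ℝ (b 0) (b 0) = (1 : ℝ) := by simp
    have h1 : inner ℝ (b 1) (b 1) = (1 : ℝ) := by simp
    have h2 : inner ℝ (b 2) (b 2) = (1 : ℝ) := by simp
    have h01 : inner ℝ (b 0) (b 1) = (0 : ℝ) := b.orthonormal.2 (by decide)
    have h02 : inner ℝ (b 0) (b 2) = (0 : ℝ) := b.orthonormal.2 (by decide)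
    have h12 : inner ℝ (b 1) (b 2) = (0 : ℝ) := b.orthonormal.2 (by decide)
    have h10 : inner ℝ (b 1) (b 0) = (0 : ℝ) := b.orthonormal.2 (by decide)
    have h20 : inner ℝ (b 2) (b 0) = (0 : ℝ) := b.orthonormal.2 (by decide)
    have h21 : inner ℝ (b 2) (b 1) = (0 : ℝ) := b.orthonormal.2 (by decide)
    rw [mem_sphere_zero_iff_norm, ← sq_eq_sq₀ (norm_nonneg _) zero_le_one,
      ← real_inner_self_eq_norm_sq]
    simp only [inner_add_left, inner_add_right, real_inner_smul_left, real_inner_smul_right,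
      h0, h1, h2, h01, h02, h12, h10, h20, h21]
    nlinarith [Real.sin_sq_add_cos_sq r, Real.sin_sq_add_cos_sq θ]⟩

theorem exists_basis_center (c : S2) :
    ∃ b : OrthonormalBasis (Fin 3) ℝ E3, b 0 = (c : E3) := by
  have hc : ‖(c : E3)‖ = 1 := mem_sphere_zero_iff_norm.mp c.2
  have ho : Orthonormal ℝ (({0} : Set (Fin 3)).domRestrict fun _ => (c : E3)) := by
    refine ⟨fun i => hc, fun i j hij => ?_⟩
    exact absurd (Subsingleton.elim i j) hij
  obtain ⟨b, hb⟩ := ho.exists_orthonormalBasis_extension_of_card_eq (by simp)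
  exact ⟨b, hb 0 rfl⟩

/-- The uniform distribution on the circle of spherical radius `r` centred at `c`: the law of the
point at a uniformly random angle. (The choice of the basis, that is, of the direction of angle `0`
and of the orientation, does not affect this law.) -/
def circleUniform (c : S2) (r : ℝ) : Measure S2 :=
  (ProbabilityTheory.cond volume (Set.Ioc 0 (2 * Real.pi))).map
    (circlePoint (exists_basis_center c).choose r)

/-- The uniform distribution on the union of four circles of equal radius `r`. (The circles have
equal lengths, and different ones share at most two points.) -/
def fourCirclesUniform (c : Fin 4 → S2) (r : ℝ) : Measure S2 :=
  (4 : ℝ≥0∞)⁻¹ • ∑ q, circleUniform (c q) r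

/-- The points `p j`, `j < n`, are evenly spaced on the circle of spherical radius `r` centred
at `c`. The position of the first of them on the circle is arbitrary. -/
def EvenlySpaced {n : ℕ} (c : S2) (r : ℝ) (p : Fin n → S2) : Prop :=
  ∃ b : OrthonormalBasis (Fin 3) ℝ E3, b 0 = (c : E3) ∧
    ∀ j : Fin n, p j = circlePoint b r (2 * Real.pi * (j : ℝ) / n)

/-! ### Blowups of antipodal drawings of `K_{4,4}` -/

/-- Two antipodal pairs. -/
def antipodalPairs (v₁ v₂ : S2) : Fin 4 → S2 := ![v₁, -v₁, v₂, -v₂]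

/-- `A`, `B` are the parts of a blowup drawing with `n` vertices per node, of the geodesic drawing
of `K_{4,4}` with parts `c`, `d`: each vertex is replaced with `n` evenly spaced points of the
circle of radius `r` around it, and all `8n` points are in general position. -/
structure IsBlowup (n : ℕ) (c d : Fin 4 → S2) (r : ℝ) (A B : Fin 4 × Fin n → S2) : Prop where
  left : ∀ q, EvenlySpaced (c q) r fun j => A (q, j)
  right : ∀ q, EvenlySpaced (d q) r fun j => B (q, j)
  generalPosition : GeneralPosition (Sum.elim A B)

end

noncomputable section

/-! The density `t(H, X)` of a crossing graph is the probability that `k` edges of the drawing,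
drawn independently with replacement, cross whenever `H` demands it. So it is essentially the mass
of a fixed set of `k`-tuples of arcs under a power of the product of the two empirical measures of
the parts. If these empirical measures converge weakly to `μ` and `ν`, so do the powers of their
products, and the densities converge as soon as the limit does not charge the boundary of that set.

Crossing is decided by signs of determinants. Strict sign conditions are open and force a crossing
(`arcs_meet_of_mem_properCrossings`); weak ones are closed and follow from a crossing
(`mem_weakCrossings_of_arcs_meet`). They differ only when three endpoints lie on a great circle,
which has probability zero if `μ` and `ν` do not charge great circles. Circles of radius strictly
between `0` and `π/2` satisfy this. The portmanteau theorem then gives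
`tendsto_homDensity_crossingGraph`, with a limit depending only on `μ` and `ν`.

Both kinds of drawing have the required weak limits: independent points by Hoeffding's inequality
and Borel–Cantelli, evenly spaced points by Riemann sums. The limit densities come from a 0/1-valued
graphon obtained by parametrizing random arcs by `[0, 1]`, and any crossing graphon has the same
densities by uniqueness of limits. -/

/-! ### Determinants and crossings -/

/-- The determinant of three vectors. -/
def det3 (x y z : E3) : ℝ :=
  x 0 * (y 1 * z 2 - y 2 * z 1) - x 1 * (y 0 * z 2 - y 2 * z 0) + x 2 * (y 0 * z 1 - y 1 * z 0)

theorem continuous_det3 : Continuous fun p : E3 × E3 × E3 => det3 p.1 p.2.1 p.2.2 := by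
  unfold det3
  fun_prop

/-- This is Cramer's linear relation between four vectors of three-space, arranged to exhibit a
vector common to the planes of `a`, `b` and of `c`, `d`. -/
theorem det3_relation (a b c d : E3) :
    det3 b c d • a + (-det3 a c d) • b = (-det3 a b d) • c + det3 a b c • d := by
  ext i
  fin_cases i <;> simp [det3] <;> ring

theorem det3_relations_of_mem {a b c d : E3} {s t u v : ℝ}
    (h : s • a + t • b = u • c + v • d) :
    s * det3 a c d + t * det3 b c d = 0 ∧ u * det3 a b c + v * det3 a b d = 0 ∧
      t * det3 a b d = u * det3 a c d := by
  have h0 := congrArg (fun x : E3 => x 0) h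
  have h1 := congrArg (fun x : E3 => x 1) h
  have h2 := congrArg (fun x : E3 => x 2) h
  simp only [PiLp.add_apply, PiLp.smul_apply, smul_eq_mul] at h0 h1 h2
  simp only [det3]
  -- Pairing the equation with `c × d`, `a × b` and `a × d` respectively eliminates two of the four
  -- vectors each time.
  refine ⟨?_, ?_, ?_⟩
  · linear_combination (c 1 * d 2 - c 2 * d 1) * h0 - (c 0 * d 2 - c 2 * d 0) * h1 +
      (c 0 * d 1 - c 1 * d 0) * h2
  · linear_combination -(a 1 * b 2 - a 2 * b 1) * h0 + (a 0 * b 2 - a 2 * b 0) * h1 -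
      (a 0 * b 1 - a 1 * b 0) * h2
  · linear_combination -(a 1 * d 2 - a 2 * d 1) * h0 + (a 0 * d 2 - a 2 * d 0) * h1 -
      (a 0 * d 1 - a 1 * d 0) * h2

/-- The pairs of arcs whose endpoints satisfy the strict sign conditions of a crossing. -/
def properCrossings : Set ((S2 × S2) × (S2 × S2)) :=
  {p | det3 p.1.2 p.2.1 p.2.2 * det3 p.1.1 p.2.1 p.2.2 < 0 ∧
    det3 p.1.1 p.1.2 p.2.2 * det3 p.1.1 p.1.2 p.2.1 < 0 ∧
    0 < det3 p.1.1 p.1.2 p.2.2 * det3 p.1.1 p.2.1 p.2.2}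

/-- The pairs of arcs whose endpoints satisfy the weak sign conditions of a crossing. -/
def weakCrossings : Set ((S2 × S2) × (S2 × S2)) :=
  {p | det3 p.1.2 p.2.1 p.2.2 * det3 p.1.1 p.2.1 p.2.2 ≤ 0 ∧
    det3 p.1.1 p.1.2 p.2.2 * det3 p.1.1 p.1.2 p.2.1 ≤ 0 ∧
    0 ≤ det3 p.1.1 p.1.2 p.2.2 * det3 p.1.1 p.2.1 p.2.2}

/-- The pairs of arcs with three endpoints on a common great circle. -/
def degeneratePairs : Set ((S2 × S2) × (S2 × S2)) :=
  {p | det3 p.1.2 p.2.1 p.2.2 = 0 ∨ det3 p.1.1 p.2.1 p.2.2 = 0 ∨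
    det3 p.1.1 p.1.2 p.2.2 = 0 ∨ det3 p.1.1 p.1.2 p.2.1 = 0}

theorem continuous_det3_sphere {X : Type*} [TopologicalSpace X] {f g h : X → S2}
    (hf : Continuous f) (hg : Continuous g) (hh : Continuous h) :
    Continuous fun x => det3 (f x) (g x) (h x) :=
  continuous_det3.comp ((continuous_subtype_val.comp hf).prodMk
    ((continuous_subtype_val.comp hg).prodMk (continuous_subtype_val.comp hh)))

theorem continuous_det3_endpoints :
    (Continuous fun p : (S2 × S2) × (S2 × S2) => det3 p.1.2 p.2.1 p.2.2) ∧
    (Continuous fun p : (S2 × S2) × (S2 × S2) => det3 p.1.1 p.2.1 p.2.2) ∧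
    (Continuous fun p : (S2 × S2) × (S2 × S2) => det3 p.1.1 p.1.2 p.2.2) ∧
    (Continuous fun p : (S2 × S2) × (S2 × S2) => det3 p.1.1 p.1.2 p.2.1) := by
  refine ⟨?_, ?_, ?_, ?_⟩ <;>
  exact continuous_det3_sphere (by fun_prop) (by fun_prop) (by fun_prop)

theorem isOpen_properCrossings : IsOpen properCrossings := by
  obtain ⟨h1, h2, h3, h4⟩ := continuous_det3_endpoints
  exact (isOpen_lt (h1.mul h2) continuous_const).inter
    ((isOpen_lt (h3.mul h4) continuous_const).inter (isOpen_lt continuous_const (h3.mul h2)))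

theorem isClosed_weakCrossings : IsClosed weakCrossings := by
  obtain ⟨h1, h2, h3, h4⟩ := continuous_det3_endpoints
  exact (isClosed_le (h1.mul h2) continuous_const).inter
    ((isClosed_le (h3.mul h4) continuous_const).inter (isClosed_le continuous_const (h3.mul h2)))

theorem properCrossings_subset_weakCrossings : properCrossings ⊆ weakCrossings :=
  fun _ h => ⟨h.1.le, h.2.1.le, h.2.2.le⟩

theorem weakCrossings_diff_subset : weakCrossings \ properCrossings ⊆ degeneratePairs := by
  rintro p ⟨⟨h1, h2, h3⟩, hp⟩
  by_contra hd
  simp only [degeneratePairs, Set.mem_ofPred_eq, not_or] at hd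
  obtain ⟨d1, d2, d3, d4⟩ := hd
  exact hp ⟨lt_of_le_of_ne h1 (mul_ne_zero d1 d2), lt_of_le_of_ne h2 (mul_ne_zero d3 d4),
    lt_of_le_of_ne h3 (mul_ne_zero d3 d2).symm⟩

theorem swap_mem_properCrossings {p q : S2 × S2} (h : (p, q) ∈ properCrossings) :
    (q, p) ∈ properCrossings := by
  obtain ⟨h1, h2, h3⟩ := h
  have e1 : det3 q.2 p.1 p.2 = det3 p.1 p.2 q.2 := by simp only [det3]; ring
  have e2 : det3 q.1 p.1 p.2 = det3 p.1 p.2 q.1 := by simp only [det3]; ring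
  have e3 : det3 q.1 q.2 p.2 = det3 p.2 q.1 q.2 := by simp only [det3]; ring
  have e4 : det3 q.1 q.2 p.1 = det3 p.1 q.1 q.2 := by simp only [det3]; ring
  simp only [properCrossings, Set.mem_ofPred_eq, e1, e2, e3, e4] at *
  refine ⟨h2, h1, ?_⟩
  set x := det3 p.2 q.1 q.2
  set y := det3 p.1 q.1 q.2
  set z := det3 p.1 p.2 q.2
  set w := det3 p.1 p.2 q.1
  have hy : 0 < y ^ 2 * z ^ 2 := by
    have : 0 < (z * y) ^ 2 := by positivity
    linarith [mul_pow z y 2]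
  -- The product `(x * y) * (z * w)` is positive and equals `(z * y) * (x * w)`, so `x * w` is
  -- positive together with `z * y`.
  by_contra hn
  have := mul_pos_of_neg_of_neg h1 h2
  nlinarith [mul_nonneg (neg_nonneg.2 (not_lt.1 hn)) h3.le]

theorem self_notMem_properCrossings (p : S2 × S2) : (p, p) ∉ properCrossings := by
  intro h
  have : det3 p.1 p.1 p.2 = 0 := by simp only [det3]; ring
  have h1 := h.1
  simp [this] at h1

/-- The first two conditions say that each plane separates the endpoints of the other arc, so the
line common to the planes meets both arcs; the third excludes that they meet it in antipodal points.
In terms of `det3_relation`, all four coefficients have the same sign. -/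
theorem arcs_meet_of_mem_properCrossings {p q : S2 × S2} (h : (p, q) ∈ properCrossings) :
    (openArc p.1 p.2 ∩ openArc q.1 q.2).Nonempty := by
  obtain ⟨a, b⟩ := p
  obtain ⟨c, d⟩ := q
  obtain ⟨h1, h2, h3⟩ := h
  simp only at h1 h2 h3
  have key : ∀ s t u v : ℝ, 0 < s → 0 < t → 0 < u → 0 < v →
      s • (a : E3) + t • (b : E3) = u • (c : E3) + v • (d : E3) →
      (openArc a b ∩ openArc c d).Nonempty := by
    intro s t u v hs ht hu hv he
    set z : E3 := s • (a : E3) + t • (b : E3) with hz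
    have hz0 : z ≠ 0 := by
      intro h0
      have h0' : s • (a : E3) + t • (b : E3) = (0 : ℝ) • (c : E3) + (0 : ℝ) • (d : E3) := by
        rw [← hz, h0]; simp
      have := (det3_relations_of_mem h0').2.2
      rw [zero_mul, mul_eq_zero] at this
      rcases this with h | h
      · exact ht.ne' h
      · rw [h] at h3; simp at h3
    have hn : 0 < ‖z‖⁻¹ := inv_pos.2 (norm_pos_iff.2 hz0)
    refine ⟨⟨‖z‖⁻¹ • z, ?_⟩, ⟨‖z‖⁻¹ * s, ‖z‖⁻¹ * t, by positivity, by positivity, ?_⟩,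
      ⟨‖z‖⁻¹ * u, ‖z‖⁻¹ * v, by positivity, by positivity, ?_⟩⟩
    · rw [mem_sphere_zero_iff_norm, norm_smul, norm_inv, norm_norm,
        inv_mul_cancel₀ (norm_ne_zero_iff.2 hz0)]
    · simp only [hz, smul_add, smul_smul]
    · simp only [he, smul_add, smul_smul]
  have rel := det3_relation (a : E3) b c d
  rcases lt_trichotomy (det3 (b : E3) c d) 0 with hb | hb | hb
  · have ha : 0 < det3 (a : E3) c d := by nlinarith
    have hd : 0 < det3 (a : E3) b d := by nlinarith
    have hc : det3 (a : E3) b c < 0 := by nlinarith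
    refine key (-det3 (b : E3) c d) (det3 (a : E3) c d) (det3 (a : E3) b d) (-det3 (a : E3) b c)
      (by linarith) ha hd (by linarith) ?_
    have := congrArg Neg.neg rel
    simpa only [neg_add, neg_smul, neg_neg] using this
  · rw [hb] at h1; simp at h1
  · have ha : det3 (a : E3) c d < 0 := by nlinarith
    have hd : det3 (a : E3) b d < 0 := by nlinarith
    have hc : 0 < det3 (a : E3) b c := by nlinarith
    exact key _ _ _ _ hb (by linarith) (by linarith) hc rel

/-- A common point makes the two determinants in each product proportional, with a factor of known
sign. Both may vanish, so only weak inequalities survive. -/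
theorem mem_weakCrossings_of_arcs_meet {p q : S2 × S2}
    (h : (openArc p.1 p.2 ∩ openArc q.1 q.2).Nonempty) : (p, q) ∈ weakCrossings := by
  obtain ⟨z, ⟨s, t, hs, ht, h1⟩, ⟨u, v, hu, hv, h2⟩⟩ := h
  obtain ⟨r1, r2, r3⟩ := det3_relations_of_mem (h1.symm.trans h2)
  simp only [weakCrossings, Set.mem_ofPred_eq]
  set x := det3 p.2 q.1 q.2
  set y := det3 p.1 q.1 q.2
  set z := det3 p.1 p.2 q.2
  set w := det3 p.1 p.2 q.1
  refine ⟨?_, ?_, ?_⟩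
  · have : t * (x * y) = -(s * y ^ 2) := by linear_combination y * r1
    nlinarith [mul_nonneg hs.le (sq_nonneg y)]
  · have : u * (z * w) = -(v * z ^ 2) := by linear_combination z * r2
    nlinarith [mul_nonneg hv.le (sq_nonneg z)]
  · have : t * (z * y) = u * y ^ 2 := by linear_combination y * r3
    nlinarith [mul_nonneg hu.le (sq_nonneg y)]

/-! ### Measures that do not charge great circles -/

/-- The measure gives mass zero to every great circle. -/
def NullOnGreatCircles (μ : Measure S2) : Prop :=
  ∀ n : E3, n ≠ 0 → ∀ᵐ x : S2 ∂μ, inner ℝ n (x : E3) ≠ 0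

/-- The cross product of two vectors. -/
def cross3 (x y : E3) : E3 :=
  !₂[x 1 * y 2 - x 2 * y 1, x 2 * y 0 - x 0 * y 2, x 0 * y 1 - x 1 * y 0]

theorem det3_eq_inner (x y z : E3) : det3 x y z = inner ℝ (cross3 x y) z := by
  simp [det3, cross3, PiLp.inner_apply, Fin.sum_univ_three]
  ring

/-- The vectors parallel to `x` lie in every plane through `x`; `n` is a normal of one such plane.
Thus measures that ignore great circles also ignore the points `±x`. -/
theorem exists_inner_eq_zero_of_cross3_eq_zero {x : E3} (hx : x ≠ 0) :
    ∃ n : E3, n ≠ 0 ∧ ∀ y, cross3 x y = 0 → inner ℝ n y = 0 := by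
  have hx' : ∃ i, x i ≠ 0 := by
    by_contra h
    push Not at h
    exact hx (by ext i; simpa using h i)
  have hc : ∀ y : E3, cross3 x y = 0 →
      x 1 * y 2 - x 2 * y 1 = 0 ∧ x 2 * y 0 - x 0 * y 2 = 0 ∧ x 0 * y 1 - x 1 * y 0 = 0 := by
    intro y h
    refine ⟨?_, ?_, ?_⟩
    · simpa [cross3] using congrArg (fun z : E3 => z 0) h
    · simpa [cross3] using congrArg (fun z : E3 => z 1) h
    · simpa [cross3] using congrArg (fun z : E3 => z 2) h
  by_cases h : x 1 = 0 ∧ x 2 = 0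
  · refine ⟨!₂[0, 1, 0], ?_, fun y hy => ?_⟩
    · intro h0
      simpa using congrArg (fun z : E3 => z 1) h0
    · obtain ⟨i, hi⟩ := hx'
      have h0 : x 0 ≠ 0 := by
        fin_cases i
        · exact hi
        · exact absurd h.1 hi
        · exact absurd h.2 hi
      have := (hc y hy).2.2
      rw [h.1, zero_mul, sub_zero, mul_eq_zero] at this
      simpa [PiLp.inner_apply, Fin.sum_univ_three] using this.resolve_left h0
  · refine ⟨!₂[0, -x 2, x 1], ?_, fun y hy => ?_⟩
    · intro h0
      refine h ⟨?_, ?_⟩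
      · simpa using congrArg (fun z : E3 => z 2) h0
      · simpa using congrArg (fun z : E3 => z 1) h0
    · have := (hc y hy).1
      simp [PiLp.inner_apply, Fin.sum_univ_three]
      linarith

theorem S2.ne_zero (x : S2) : (x : E3) ≠ 0 := by
  have : ‖(x : E3)‖ = 1 := mem_sphere_zero_iff_norm.mp x.2
  intro h
  simp [h] at this

theorem NullOnGreatCircles.ae_cross3_ne_zero {μ : Measure S2} (h : NullOnGreatCircles μ) (a : S2) :
    ∀ᵐ b : S2 ∂μ, cross3 (a : E3) b ≠ 0 := by
  obtain ⟨n, hn, hn'⟩ := exists_inner_eq_zero_of_cross3_eq_zero (S2.ne_zero a)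
  filter_upwards [h n hn] with b hb hc using hb (hn' b hc)

theorem NullOnGreatCircles.ae_det3_ne_zero {μ : Measure S2} (h : NullOnGreatCircles μ) {x y : E3}
    (hxy : cross3 x y ≠ 0) : ∀ᵐ c : S2 ∂μ, det3 x y c ≠ 0 := by
  filter_upwards [h _ hxy] with c hc
  rwa [det3_eq_inner]

/-- By Fubini: each determinant involves three independent points. Two of them are almost surely not
parallel, and then the third almost surely avoids the great circle through them. -/
theorem ae_prod_notMem_degeneratePairs {μ ν : Measure S2} [IsProbabilityMeasure μ]
    [IsProbabilityMeasure ν] (hμ : NullOnGreatCircles μ) (hν : NullOnGreatCircles ν) :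
    ∀ᵐ p ∂(μ.prod ν).prod (μ.prod ν), p ∉ degeneratePairs := by
  obtain ⟨h1, h2, h3, h4⟩ := continuous_det3_endpoints
  have meas : ∀ {X : Type} [MeasurableSpace X] {f : X → ℝ}, Measurable f →
      MeasurableSet {x | f x ≠ 0} := fun hf => (hf (measurableSet_singleton 0)).compl
  have c1 : ∀ᵐ p ∂(μ.prod ν).prod (μ.prod ν), det3 p.1.2 p.2.1 p.2.2 ≠ 0 := by
    refine (Measure.ae_prod_iff_ae_ae (meas h1.measurable)).2 (ae_of_all _ fun p => ?_)
    refine (Measure.ae_prod_iff_ae_ae (meas (h1.comp (.prodMk_right p)).measurable)).2 ?_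
    filter_upwards [hμ.ae_cross3_ne_zero p.2] with c hc using hν.ae_det3_ne_zero hc
  have c2 : ∀ᵐ p ∂(μ.prod ν).prod (μ.prod ν), det3 p.1.1 p.2.1 p.2.2 ≠ 0 := by
    refine (Measure.ae_prod_iff_ae_ae (meas h2.measurable)).2 (ae_of_all _ fun p => ?_)
    refine (Measure.ae_prod_iff_ae_ae (meas (h2.comp (.prodMk_right p)).measurable)).2 ?_
    filter_upwards [hμ.ae_cross3_ne_zero p.1] with c hc using hν.ae_det3_ne_zero hc
  have hcross : ∀ᵐ p ∂μ.prod ν, cross3 (p.1 : E3) p.2 ≠ 0 := by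
    have hm : Measurable fun p : S2 × S2 => cross3 (p.1 : E3) p.2 := by
      unfold cross3
      fun_prop
    exact (Measure.ae_prod_iff_ae_ae (hm (measurableSet_singleton 0)).compl).2
      (ae_of_all _ fun a => hν.ae_cross3_ne_zero a)
  have c3 : ∀ᵐ p ∂(μ.prod ν).prod (μ.prod ν), det3 p.1.1 p.1.2 p.2.2 ≠ 0 := by
    refine (Measure.ae_prod_iff_ae_ae (meas h3.measurable)).2 ?_
    filter_upwards [hcross] with p hp
    exact Measure.quasiMeasurePreserving_snd.ae (hν.ae_det3_ne_zero hp)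
  have c4 : ∀ᵐ p ∂(μ.prod ν).prod (μ.prod ν), det3 p.1.1 p.1.2 p.2.1 ≠ 0 := by
    refine (Measure.ae_prod_iff_ae_ae (meas h4.measurable)).2 ?_
    filter_upwards [hcross] with p hp
    exact Measure.quasiMeasurePreserving_fst.ae (hμ.ae_det3_ne_zero hp)
  filter_upwards [c1, c2, c3, c4] with p p1 p2 p3 p4
  simp [degeneratePairs, p1, p2, p3, p4]

/-! ### Uniform distributions on circles -/

theorem inner_circlePoint (b : OrthonormalBasis (Fin 3) ℝ E3) (r θ : ℝ) (n : E3) :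
    inner ℝ n (circlePoint b r θ : E3) = Real.cos r * inner ℝ n (b 0) +
      Real.sin r * (Real.cos θ * inner ℝ n (b 1) + Real.sin θ * inner ℝ n (b 2)) := by
  simp only [circlePoint, inner_add_right, real_inner_smul_right]

theorem continuous_circlePoint (b : OrthonormalBasis (Fin 3) ℝ E3) (r : ℝ) :
    Continuous (circlePoint b r) := by
  unfold circlePoint
  exact Continuous.subtype_mk (by fun_prop) _

/-- A real analytic function that is not identically zero has a discrete, hence null, zero set. The
values at `0`, `π` and `π/2` determine the three coefficients. -/
theorem ae_trig_ne_zero {A B C : ℝ} (h : ¬(A = 0 ∧ B = 0 ∧ C = 0)) :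
    ∀ᵐ θ : ℝ, A + (B * Real.cos θ + C * Real.sin θ) ≠ 0 := by
  set f : ℝ → ℝ := fun θ => A + (B * Real.cos θ + C * Real.sin θ) with hf
  have hfa : AnalyticOnNhd ℝ f Set.univ :=
    analyticOnNhd_const.add ((analyticOnNhd_const.mul Real.analyticOnNhd_cos).add
      (analyticOnNhd_const.mul Real.analyticOnNhd_sin))
  have hx : ∃ x, f x ≠ 0 := by
    by_contra hx
    push Not at hx
    have e0 := hx 0
    have e1 := hx Real.pi
    have e2 := hx (Real.pi / 2)
    simp [hf] at e0 e1 e2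
    exact h ⟨by linarith, by linarith, by linarith⟩
  obtain ⟨x, hx⟩ := hx
  have h1 := hfa.preimage_zero_mem_codiscrete hx
  have h2 := ae_restrict_le_codiscreteWithin (μ := volume) MeasurableSet.univ h1
  rw [Measure.restrict_univ] at h2
  filter_upwards [h2] with θ hθ
  simpa using hθ

instance (c : S2) (r : ℝ) : IsProbabilityMeasure (circleUniform c r) := by
  have : IsProbabilityMeasure
      (ProbabilityTheory.cond (volume : Measure ℝ) (Set.Ioc 0 (2 * Real.pi))) := by
    refine ProbabilityTheory.cond_isProbabilityMeasure_of_finite ?_ ?_ <;>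
      simp [Real.volume_Ioc, Real.pi_pos, ENNReal.mul_eq_top]
  exact Measure.isProbabilityMeasure_map (continuous_circlePoint _ r).aemeasurable

/-- The bounds on `r` make `sin r` and `cos r` nonzero: the circle is neither a point nor a great
circle, and a nonzero `n` gives a nonzero trigonometric polynomial of the angle. -/
theorem nullOnGreatCircles_circleUniform (c : S2) {r : ℝ} (hr₀ : 0 < r) (hr : r < Real.pi / 2) :
    NullOnGreatCircles (circleUniform c r) := by
  intro n hn
  set b := (exists_basis_center c).choose
  have hm : MeasurableSet {x : S2 | inner ℝ n (x : E3) ≠ 0} := by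
    have : Continuous fun x : S2 => inner ℝ n (x : E3) := by fun_prop
    exact (this.measurable (measurableSet_singleton 0)).compl
  refine (ae_map_iff (continuous_circlePoint b r).aemeasurable hm).2 ?_
  refine ProbabilityTheory.cond_absolutelyContinuous.ae_le ?_
  have hs : Real.sin r ≠ 0 := (Real.sin_pos_of_pos_of_lt_pi hr₀ (by linarith)).ne'
  have hc : Real.cos r ≠ 0 := (Real.cos_pos_of_mem_Ioo ⟨by linarith, hr⟩).ne'
  have key := ae_trig_ne_zero (A := Real.cos r * inner ℝ n (b 0))
    (B := Real.sin r * inner ℝ n (b 1)) (C := Real.sin r * inner ℝ n (b 2)) ?_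
  · filter_upwards [key] with θ hθ
    rw [inner_circlePoint]
    convert hθ using 1
    ring
  · rintro ⟨h0, h1, h2⟩
    apply hn
    have h0' := (mul_eq_zero.1 h0).resolve_left hc
    have h1' := (mul_eq_zero.1 h1).resolve_left hs
    have h2' := (mul_eq_zero.1 h2).resolve_left hs
    rw [← b.sum_repr' n, Fin.sum_univ_three, real_inner_comm, h0', real_inner_comm, h1',
      real_inner_comm, h2']
    simp

instance (c : Fin 4 → S2) (r : ℝ) : IsProbabilityMeasure (fourCirclesUniform c r) := by
  constructor
  simp [fourCirclesUniform]
  exact ENNReal.inv_mul_cancel (by simp) (by simp)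

theorem nullOnGreatCircles_fourCirclesUniform (c : Fin 4 → S2) {r : ℝ} (hr₀ : 0 < r)
    (hr : r < Real.pi / 2) : NullOnGreatCircles (fourCirclesUniform c r) := by
  intro n hn
  refine Measure.smul_absolutelyContinuous.ae_le ?_
  rw [← Measure.sum_fintype]
  exact Measure.ae_sum_iff.2 fun q => nullOnGreatCircles_circleUniform (c q) hr₀ hr n hn

/-! ### Empirical measures -/

section Empirical

variable {X Y ι κ : Type} [MeasurableSpace X] [MeasurableSpace Y] [Fintype ι] [Fintype κ]

/-- The uniform distribution on a finite family of points. -/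
def empiricalMeasure (p : ι → X) : Measure X :=
  (Fintype.card ι : ℝ≥0∞)⁻¹ • ∑ i, Measure.dirac (p i)

theorem empiricalMeasure_apply (p : ι → X) {s : Set X} [DecidablePred fun i => p i ∈ s]
    (hs : MeasurableSet s) :
    empiricalMeasure p s = (Fintype.card ι : ℝ≥0∞)⁻¹ * (Finset.univ.filter fun i => p i ∈ s).card := by
  simp [empiricalMeasure, Measure.dirac_apply' _ hs, Set.indicator_apply, Finset.sum_boole]

instance isProbabilityMeasure_empiricalMeasure [Nonempty ι] (p : ι → X) :
    IsProbabilityMeasure (empiricalMeasure p) := by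
  constructor
  classical
  rw [empiricalMeasure_apply p MeasurableSet.univ]
  simp [Finset.card_univ]
  exact ENNReal.inv_mul_cancel (by simp) (by simp)

theorem integral_empiricalMeasure (p : ι → X) {f : X → ℝ} (hf : StronglyMeasurable f) :
    ∫ x, f x ∂empiricalMeasure p = (Fintype.card ι : ℝ)⁻¹ * ∑ i, f (p i) := by
  rw [empiricalMeasure, integral_smul_measure, integral_finsetSum_measure]
  · simp [integral_dirac' _ _ hf]
  · intro i _
    exact (integrable_dirac' hf (by simp))

theorem empiricalMeasure_prod [Nonempty ι] [Nonempty κ] (p : ι → X) (q : κ → Y) :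
    (empiricalMeasure p).prod (empiricalMeasure q) =
      empiricalMeasure fun i : ι × κ => (p i.1, q i.2) := by
  classical
  refine Measure.prod_eq fun s t hs ht => ?_
  rw [empiricalMeasure_apply _ (hs.prod ht), empiricalMeasure_apply _ hs,
    empiricalMeasure_apply _ ht]
  have : (Finset.univ.filter fun i : ι × κ => (p i.1, q i.2) ∈ s ×ˢ t) =
      (Finset.univ.filter fun i => p i ∈ s) ×ˢ (Finset.univ.filter fun i => q i ∈ t) := by
    ext i
    simp
  rw [this, Finset.card_product, Fintype.card_prod, Nat.cast_mul, Nat.cast_mul,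
    ENNReal.mul_inv (by simp) (by simp)]
  ring

/-- Sampling `k` indices with replacement amounts to choosing a map from `Fin k` uniformly, which
turns counts of maps into masses of sets. -/
theorem empiricalMeasure_pi [Nonempty ι] (p : ι → X) (k : ℕ) :
    Measure.pi (fun _ : Fin k => empiricalMeasure p) =
      empiricalMeasure fun g : Fin k → ι => p ∘ g := by
  classical
  refine (Measure.pi_eq fun s hs => ?_)
  rw [empiricalMeasure_apply _ (MeasurableSet.univ_pi hs)]
  simp_rw [empiricalMeasure_apply _ (hs _)]
  have : (Finset.univ.filter fun g : Fin k → ι => p ∘ g ∈ Set.univ.pi s) =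
      Fintype.piFinset fun j => Finset.univ.filter fun i => p i ∈ s j := by
    ext i
    simp
  rw [this, Fintype.card_piFinset, Finset.prod_mul_distrib, Finset.prod_const, Fintype.card_fun,
    Finset.card_univ, Fintype.card_fin, Nat.cast_pow, ENNReal.inv_pow, Nat.cast_prod]

/-- The empirical measure as a probability measure. -/
def empiricalProb [Nonempty ι] (p : ι → X) : ProbabilityMeasure X :=
  ⟨empiricalMeasure p, inferInstance⟩

end Empirical

/-! ### Homomorphism densities of crossing graphs -/

/-- The tuples of arcs for which each edge of `H` is mapped into the relation `R`. -/
def homSet {X : Type} {k : ℕ} (H : SimpleGraph (Fin k)) (R : Set (X × X)) : Set (Fin k → X) :=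
  {x | ∀ i j, H.Adj i j → (x i, x j) ∈ R}

theorem homSet_eq_iInter {X : Type} {k : ℕ} (H : SimpleGraph (Fin k)) (R : Set (X × X)) :
    homSet H R = ⋂ i, ⋂ j, ⋂ _ : H.Adj i j, (fun x : Fin k → X => (x i, x j)) ⁻¹' R := by
  ext x
  simp [homSet]

theorem isOpen_homSet {X : Type} [TopologicalSpace X] {k : ℕ} (H : SimpleGraph (Fin k))
    {R : Set (X × X)} (hR : IsOpen R) : IsOpen (homSet H R) := by
  rw [homSet_eq_iInter]
  exact isOpen_iInter_of_finite fun i => isOpen_iInter_of_finite fun j =>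
    isOpen_iInter_of_finite fun _ => hR.preimage (by fun_prop)

theorem isClosed_homSet {X : Type} [TopologicalSpace X] {k : ℕ} (H : SimpleGraph (Fin k))
    {R : Set (X × X)} (hR : IsClosed R) : IsClosed (homSet H R) := by
  rw [homSet_eq_iInter]
  exact isClosed_iInter fun i => isClosed_iInter fun j =>
    isClosed_iInter fun _ => hR.preimage (by fun_prop)

theorem measure_pi_pair_null {X : Type} [MeasurableSpace X] {k : ℕ} (μ : Measure X)
    [IsProbabilityMeasure μ] {i j : Fin k} (hij : i ≠ j) {p : X × X → Prop}
    (hp : ∀ᵐ x ∂μ.prod μ, p x) : ∀ᵐ x ∂Measure.pi fun _ : Fin k => μ, p (x i, x j) := by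
  have h := (ProbabilityTheory.iIndepFun_pi (μ := fun _ : Fin k => μ) (X := fun _ => id)
    fun _ => aemeasurable_id).indepFun hij
  have h2 := h.map_prod_eq_prod_map_map (measurable_pi_apply i).aemeasurable
    (measurable_pi_apply j).aemeasurable
  have e : ∀ l : Fin k, (Measure.pi fun _ : Fin k => μ).map (fun x => x l) = μ := fun l =>
    (measurePreserving_eval (fun _ : Fin k => μ) l).map_eq
  rw [e, e] at h2
  rw [← h2] at hp
  exact ae_of_ae_map (by fun_prop) hp

/-- `H` has no loops, so only pairs of distinct coordinates matter, and two distinct coordinates are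
independent. -/
theorem homSet_diff_null {k : ℕ} (H : SimpleGraph (Fin k)) {μ ν : Measure S2}
    [IsProbabilityMeasure μ] [IsProbabilityMeasure ν] (hμ : NullOnGreatCircles μ)
    (hν : NullOnGreatCircles ν) :
    Measure.pi (fun _ : Fin k => μ.prod ν) (homSet H weakCrossings \ homSet H properCrossings) =
      0 := by
  have hd := ae_prod_notMem_degeneratePairs hμ hν
  have h : ∀ᵐ x ∂Measure.pi (fun _ : Fin k => μ.prod ν), ∀ i j, i ≠ j →
      (x i, x j) ∉ degeneratePairs := by
    refine ae_all_iff.2 fun i => ae_all_iff.2 fun j => ?_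
    by_cases hij : i = j
    · simp [hij]
    · filter_upwards [measure_pi_pair_null _ hij hd] with x hx _ using hx
  refine measure_mono_null ?_ h
  rintro x ⟨h1, h2⟩ h3
  refine h2 fun i j hij => ?_
  by_contra hc
  exact h3 i j hij.ne (weakCrossings_diff_subset ⟨h1 i j hij, hc⟩)

section Count

variable {ι κ : Type} [Fintype ι] [Fintype κ] (a : ι → S2) (b : κ → S2)

theorem homDensity_crossingGraph_bounds [Nonempty ι] [Nonempty κ] {k : ℕ} (H : SimpleGraph (Fin k)) :
    let M := Measure.pi fun _ : Fin k => (empiricalMeasure a).prod (empiricalMeasure b)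
    M.real (homSet H properCrossings) ≤ homDensity H (crossingGraph a b) ∧
      homDensity H (crossingGraph a b) ≤ M.real (homSet H weakCrossings) := by
  classical
  intro M
  have hM : ∀ s, MeasurableSet s → M.real s = (Nat.card {g : Fin k → ι × κ |
      (fun i => (a (g i).1, b (g i).2)) ∈ s} : ℝ) / (Nat.card (ι × κ) : ℝ) ^ k := by
    intro s hs
    simp only [M, Measure.real, empiricalMeasure_prod, empiricalMeasure_pi]
    rw [empiricalMeasure_apply _ hs]
    simp [Nat.card_eq_fintype_card, Fintype.card_subtype, div_eq_inv_mul, Function.comp_def]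
  have hinj : Function.Injective
      (fun φ : H →g crossingGraph a b => (φ : Fin k → ι × κ)) := DFunLike.coe_injective
  have hcard : Nat.card (H →g crossingGraph a b) = Nat.card (Set.range
      (fun φ : H →g crossingGraph a b => (φ : Fin k → ι × κ))) :=
    (Nat.card_range_of_injective hinj).symm
  rw [hM _ (isOpen_homSet H isOpen_properCrossings).measurableSet,
    hM _ (isClosed_homSet H isClosed_weakCrossings).measurableSet, homDensity, hcard]
  constructor
  · gcongr
    refine Nat.card_mono (Set.toFinite _) ?_
    intro g hg
    refine ⟨⟨g, fun {i j} hij => ?_⟩, rfl⟩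
    have h := hg i j hij
    -- Adjacent edges must be different; this is automatic, since an arc paired with itself fails
    -- the strict sign conditions.
    refine ⟨fun he => ?_, arcs_meet_of_mem_properCrossings h⟩
    simp only [he] at h
    exact self_notMem_properCrossings _ h
  · gcongr
    refine Nat.card_mono (Set.toFinite _) ?_
    rintro _ ⟨φ, rfl⟩ i j hij
    exact mem_weakCrossings_of_arcs_meet (φ.map_rel hij).2

end Count

theorem tendsto_homDensity_crossingGraph {ι κ : ℕ → Type} [∀ n, Fintype (ι n)]
    [∀ n, Fintype (κ n)] [∀ n, Nonempty (ι n)] [∀ n, Nonempty (κ n)] (a : ∀ n, ι n → S2)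
    (b : ∀ n, κ n → S2) (μ ν : ProbabilityMeasure S2) (hμ : NullOnGreatCircles (μ : Measure S2))
    (hν : NullOnGreatCircles (ν : Measure S2))
    (ha : Tendsto (fun n => empiricalProb (a n)) atTop (𝓝 μ))
    (hb : Tendsto (fun n => empiricalProb (b n)) atTop (𝓝 ν)) {k : ℕ} (H : SimpleGraph (Fin k)) :
    Tendsto (fun n => homDensity H (crossingGraph (a n) (b n))) atTop
      (𝓝 ((Measure.pi fun _ : Fin k => (μ : Measure S2).prod (ν : Measure S2)).real
        (homSet H properCrossings))) := by
  have hprod : Tendsto (fun n => (empiricalProb (a n)).prod (empiricalProb (b n))) atTop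
      (𝓝 (μ.prod ν)) :=
    (ProbabilityMeasure.continuous_prod.tendsto (μ, ν)).comp (ha.prodMk_nhds hb)
  have hpi : Tendsto (fun n => ProbabilityMeasure.pi fun _ : Fin k =>
      (empiricalProb (a n)).prod (empiricalProb (b n))) atTop
      (𝓝 (ProbabilityMeasure.pi fun _ : Fin k => μ.prod ν)) :=
    (ProbabilityMeasure.continuous_pi.tendsto (fun _ : Fin k => μ.prod ν)).comp
      (tendsto_pi_nhds.2 fun _ => hprod)
  have hopen := ProbabilityMeasure.le_liminf_measure_open_of_tendsto hpi
    (isOpen_homSet H isOpen_properCrossings)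
  have hclosed := ProbabilityMeasure.limsup_measure_closed_le_of_tendsto hpi
    (isClosed_homSet H isClosed_weakCrossings)
  have hsub : homSet H properCrossings ⊆ homSet H weakCrossings :=
    fun x hx i j hij => properCrossings_subset_weakCrossings (hx i j hij)
  have hnull := homSet_diff_null H hμ hν
  -- The portmanteau bounds for the open and the closed set pinch, as the difference of the two sets
  -- is null for the limit; the masses of both sets converge, to the same value.
  have t1 := tendsto_measure_of_le_liminf_measure_of_limsup_measure_le subset_rfl hsub hnull
    hopen hclosed
  have t2 := tendsto_measure_of_le_liminf_measure_of_limsup_measure_le hsub subset_rfl hnull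
    hopen hclosed
  have heq : Measure.pi (fun _ : Fin k => (μ : Measure S2).prod (ν : Measure S2))
        (homSet H weakCrossings) =
      Measure.pi (fun _ : Fin k => (μ : Measure S2).prod (ν : Measure S2))
        (homSet H properCrossings) :=
    le_antisymm (measure_mono_ae (ae_le_set.2 hnull)) (measure_mono hsub)
  rw [heq] at t2
  have f1 := (ENNReal.tendsto_toReal (measure_ne_top _ _)).comp t1
  have f2 := (ENNReal.tendsto_toReal (measure_ne_top _ _)).comp t2
  exact tendsto_of_tendsto_of_tendsto_of_le_of_le f1 f2
    (fun n => (homDensity_crossingGraph_bounds (a n) (b n) H).1)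
    (fun n => (homDensity_crossingGraph_bounds (a n) (b n) H).2)

/-! ### The limit graphon -/

/-- Every probability measure on a standard Borel space is the image of Lebesgue measure under some
`φ : I → S2 × S2`. The graphon is the indicator of a proper crossing of `φ s` and `φ t`. -/
theorem exists_graphon_homDensity_eq (μ : Measure (S2 × S2)) [IsProbabilityMeasure μ] :
    ∃ W : Graphon, ∀ (k : ℕ) (H : SimpleGraph (Fin k)),
      W.homDensity H = (Measure.pi fun _ : Fin k => μ).real (homSet H properCrossings) := by
  classical
  have := nonempty_of_isProbabilityMeasure μ
  obtain ⟨φ, hφ, hμ⟩ := μ.exists_measurable_map_eq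
  have hR : MeasurableSet {q : I × I | (φ q.1, φ q.2) ∈ properCrossings} :=
    (show Measurable fun q : I × I => (φ q.1, φ q.2) by fun_prop)
      isOpen_properCrossings.measurableSet
  refine ⟨⟨fun s t => if (φ s, φ t) ∈ properCrossings then 1 else 0, ?_, ?_, ?_, ?_⟩, ?_⟩
  · exact Measurable.ite hR measurable_const measurable_const
  · intro s t
    simp only [show (φ s, φ t) ∈ properCrossings ↔ (φ t, φ s) ∈ properCrossings from
      ⟨swap_mem_properCrossings, swap_mem_properCrossings⟩]
  · intro s t
    split_ifs <;> norm_num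
  · intro s t
    split_ifs <;> norm_num
  · intro k H
    have hmp : MeasurePreserving (fun x : Fin k → I => fun i => φ (x i)) volume
        (Measure.pi fun _ : Fin k => μ) :=
      measurePreserving_pi (fun _ => volume) (fun _ => μ) fun _ => ⟨hφ, hμ⟩
    have hS := (isOpen_homSet H isOpen_properCrossings).measurableSet
    rw [← hmp.measureReal_preimage hS.nullMeasurableSet, Graphon.homDensity,
      ← integral_indicator_one (hmp.measurable hS)]
    congr 1
    ext x
    simp only [Finset.prod_ite_zero, Finset.prod_const_one, Set.indicator_apply, Pi.one_apply]
    refine if_congr ?_ rfl rfl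
    simp only [homSet, Finset.mem_filter, Finset.mem_univ, true_and, Set.mem_preimage,
      Set.mem_ofPred_eq]
    constructor
    · intro h i j hij
      rcases lt_or_gt_of_ne hij.ne with hlt | hlt
      · exact h (i, j) ⟨hlt, hij⟩
      · exact swap_mem_properCrossings (h (j, i) ⟨hlt, hij.symm⟩)
    · exact fun h e he => h _ _ he.2

/-! ### Convergence of empirical measures of independent points -/

theorem tendsto_empiricalProb {ι : ℕ → Type} [∀ n, Fintype (ι n)] [∀ n, Nonempty (ι n)]
    (p : ∀ n, ι n → S2) (μ : ProbabilityMeasure S2)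
    (h : ∀ f : C(S2, ℝ), Tendsto (fun n => (Fintype.card (ι n) : ℝ)⁻¹ * ∑ i, f (p n i)) atTop
      (𝓝 (∫ x, f x ∂(μ : Measure S2)))) :
    Tendsto (fun n => empiricalProb (p n)) atTop (𝓝 μ) := by
  refine ProbabilityMeasure.tendsto_iff_forall_integral_tendsto.2 fun f => ?_
  refine (h f.toContinuousMap).congr fun n => ?_
  exact (integral_empiricalMeasure (p n) f.continuous.stronglyMeasurable).symm

/-- Hoeffding's inequality. The rate `c` does not depend on `n`, so the bounds are summable. -/
theorem exists_deviation_bound (μ : Measure S2) [IsProbabilityMeasure μ] (f : C(S2, ℝ)) {ε : ℝ}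
    (hε : 0 < ε) : ∃ c < 0, ∀ n : ℕ, (Measure.pi fun _ : Fin n => μ).real
      {x | ε ≤ (n : ℝ)⁻¹ * ∑ i, f (x i) - ∫ y, f y ∂μ} ≤ Real.exp (n * c) := by
  have hsub : ∃ C : NNReal, 0 < C ∧ ∀ (n : ℕ) (i : Fin n), ProbabilityTheory.HasSubgaussianMGF
      (fun x : Fin n → S2 => f (x i) - ∫ y, f y ∂μ) C (Measure.pi fun _ : Fin n => μ) := by
    -- The bound `‖f‖ + 1` in place of `‖f‖` keeps the variance proxy positive even for `f = 0`.
    refine ⟨(‖(‖f‖ + 1) - (-(‖f‖ + 1))‖₊ / 2) ^ 2, ?_, fun n i => ?_⟩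
    · have h : (‖f‖ + 1) - (-(‖f‖ + 1)) ≠ 0 := by linarith [norm_nonneg f]
      have : 0 < ‖(‖f‖ + 1) - (-(‖f‖ + 1))‖₊ := by simpa only [nnnorm_pos] using h
      positivity
    · have hf : Measurable fun x : Fin n → S2 => f (x i) :=
        f.continuous.measurable.comp (measurable_pi_apply i)
      have h := ProbabilityTheory.hasSubgaussianMGF_of_mem_Icc
        (μ := Measure.pi fun _ : Fin n => μ) (a := -(‖f‖ + 1)) (b := ‖f‖ + 1) hf.aemeasurable
        (ae_of_all _ fun x => by
          have := f.norm_coe_le_norm (x i)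
          rw [Real.norm_eq_abs, abs_le] at this
          exact ⟨by linarith, by linarith⟩)
      rwa [integral_comp_eval (μ := fun _ : Fin n => μ)
        f.continuous.aestronglyMeasurable] at h
  obtain ⟨C, hC, hsub⟩ := hsub
  refine ⟨-(ε ^ 2 / (2 * C)), by have : (0 : ℝ) < C := hC; simp; positivity, fun n => ?_⟩
  rcases Nat.eq_zero_or_pos n with rfl | hn
  · simp
  · have hind : ProbabilityTheory.iIndepFun
        (fun (i : Fin n) (x : Fin n → S2) => f (x i) - ∫ y, f y ∂μ)
        (Measure.pi fun _ : Fin n => μ) :=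
      ProbabilityTheory.iIndepFun_pi (μ := fun _ : Fin n => μ)
        (X := fun _ x => f x - ∫ y, f y ∂μ)
        fun _ => (f.continuous.measurable.sub_const _).aemeasurable
    have hn' : (0 : ℝ) < n := Nat.cast_pos.2 hn
    have h := ProbabilityTheory.HasSubgaussianMGF.measure_sum_ge_le_of_iIndepFun hind
      (s := Finset.univ) (fun i _ => hsub n i) (ε := n * ε) (by positivity)
    have hset : {x : Fin n → S2 | ε ≤ (n : ℝ)⁻¹ * ∑ i, f (x i) - ∫ y, f y ∂μ} =
        {x | n * ε ≤ ∑ i, (f (x i) - ∫ y, f y ∂μ)} := by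
      ext x
      simp only [Set.mem_ofPred_eq, Finset.sum_sub_distrib, Finset.sum_const, Finset.card_univ,
        Fintype.card_fin, nsmul_eq_mul]
      rw [← mul_le_mul_iff_right₀ hn', mul_sub, mul_inv_cancel_left₀ hn'.ne']
    rw [hset]
    refine h.trans (le_of_eq ?_)
    have hC' : (C : ℝ) ≠ 0 := by exact_mod_cast hC.ne'
    congr 1
    simp
    field_simp

/-- The first Borel–Cantelli lemma needs no independence, so the samples for different `n` may
depend on each other arbitrarily. -/
theorem ae_eventually_average_lt {Ω : Type} [MeasurableSpace Ω] {P : Measure Ω}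
    {μ : Measure S2} [IsProbabilityMeasure μ] {A : ∀ n : ℕ, Ω → Fin n → S2}
    (hA : ∀ n, ProbabilityTheory.HasLaw (A n) (Measure.pi fun _ => μ) P) (f : C(S2, ℝ)) {ε : ℝ}
    (hε : 0 < ε) : ∀ᵐ ω ∂P, ∀ᶠ n : ℕ in atTop,
      (n : ℝ)⁻¹ * ∑ i, f (A n ω i) - ∫ y, f y ∂μ < ε := by
  obtain ⟨c, hc, hb⟩ := exists_deviation_bound μ f hε
  have hmeas : ∀ n : ℕ, MeasurableSet
      {x : Fin n → S2 | ε ≤ (n : ℝ)⁻¹ * ∑ i, f (x i) - ∫ y, f y ∂μ} := fun n => by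
    refine measurableSet_le measurable_const (Continuous.measurable ?_)
    fun_prop
  have hle : ∀ n : ℕ, P {ω | ε ≤ (n : ℝ)⁻¹ * ∑ i, f (A n ω i) - ∫ y, f y ∂μ} ≤
      ENNReal.ofReal (Real.exp (n * c)) := fun n => by
    rw [(hA n).measure_eq (p := fun x => ε ≤ (n : ℝ)⁻¹ * ∑ i, f (x i) - ∫ y, f y ∂μ) (hmeas n)]
    rw [← ENNReal.ofReal_toReal (measure_ne_top (Measure.pi fun _ : Fin n => μ) _)]
    exact ENNReal.ofReal_le_ofReal (hb n)
  have hsum : ∑' n : ℕ, P {ω | ε ≤ (n : ℝ)⁻¹ * ∑ i, f (A n ω i) - ∫ y, f y ∂μ} ≠ ∞ :=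
    ne_top_of_le_ne_top (Real.summable_exp_nat_mul_iff.2 hc).tsum_ofReal_ne_top
      (ENNReal.tsum_le_tsum hle)
  filter_upwards [ae_eventually_notMem hsum] with ω hω
  filter_upwards [hω] with n hn
  simpa using hn

theorem abs_average_le {n : ℕ} (f : C(S2, ℝ)) (x : Fin n → S2) :
    |(n : ℝ)⁻¹ * ∑ i, f (x i)| ≤ ‖f‖ := by
  rcases Nat.eq_zero_or_pos n with rfl | hn
  · simp
  · have hn' : (0 : ℝ) < n := Nat.cast_pos.2 hn
    rw [abs_mul, abs_of_pos (inv_pos.2 hn'), inv_mul_le_iff₀ hn']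
    refine (Finset.abs_sum_le_sum_abs _ _).trans ?_
    refine (Finset.sum_le_sum fun i _ => f.norm_coe_le_norm (x i)).trans ?_
    simp

theorem ae_tendsto_average {Ω : Type} [MeasurableSpace Ω] {P : Measure Ω}
    {μ : Measure S2} [IsProbabilityMeasure μ] {A : ∀ n : ℕ, Ω → Fin n → S2}
    (hA : ∀ n, ProbabilityTheory.HasLaw (A n) (Measure.pi fun _ => μ) P) :
    ∀ᵐ ω ∂P, ∀ f : C(S2, ℝ),
      Tendsto (fun n : ℕ => (n : ℝ)⁻¹ * ∑ i, f (A n ω i)) atTop (𝓝 (∫ y, f y ∂μ)) := by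
  -- One null set serves all `f` because `C(S2, ℝ)` is separable: countably many functions,
  -- tolerances and signs suffice, and a general `f` is approximated uniformly within `ε / 3`.
  have hall : ∀ᵐ ω ∂P, ∀ j m : ℕ,
      (∀ᶠ n : ℕ in atTop, (n : ℝ)⁻¹ * ∑ i, TopologicalSpace.denseSeq C(S2, ℝ) j (A n ω i) -
        ∫ y, TopologicalSpace.denseSeq C(S2, ℝ) j y ∂μ < 1 / ((m : ℝ) + 1)) ∧
      (∀ᶠ n : ℕ in atTop, (n : ℝ)⁻¹ * ∑ i, (-TopologicalSpace.denseSeq C(S2, ℝ) j) (A n ω i) -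
        ∫ y, (-TopologicalSpace.denseSeq C(S2, ℝ) j) y ∂μ < 1 / ((m : ℝ) + 1)) :=
    ae_all_iff.2 fun j => ae_all_iff.2 fun m =>
      (ae_eventually_average_lt hA _ Nat.one_div_pos_of_nat).and
        (ae_eventually_average_lt hA _ Nat.one_div_pos_of_nat)
  filter_upwards [hall] with ω hω f
  rw [Metric.tendsto_atTop']
  intro ε hε
  obtain ⟨m, hm⟩ := exists_nat_one_div_lt (show 0 < ε / 3 by linarith)
  obtain ⟨j, hj⟩ := (TopologicalSpace.denseRange_denseSeq C(S2, ℝ)).exists_dist_lt f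
    (show 0 < ε / 3 by linarith)
  set g := TopologicalSpace.denseSeq C(S2, ℝ) j
  obtain ⟨h1, h2⟩ := hω j m
  obtain ⟨N, hN⟩ := eventually_atTop.1 (h1.and h2)
  refine ⟨N, fun n hn => ?_⟩
  obtain ⟨l1, l2⟩ := hN n hn.le
  have hfg : ‖f - g‖ < ε / 3 := by rwa [← dist_eq_norm]
  have e1 := abs_average_le (f - g) (A n ω)
  have e2 : |∫ y, (f - g) y ∂μ| ≤ ‖f - g‖ := by
    have := norm_integral_le_of_norm_le_const (μ := μ)
      (ae_of_all _ fun y => (f - g).norm_coe_le_norm y)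
    simpa using this
  have hint : ∀ h : C(S2, ℝ), Integrable h μ := fun h =>
    h.continuous.integrable_of_hasCompactSupport (HasCompactSupport.of_compactSpace h)
  simp only [ContinuousMap.sub_apply, Finset.sum_sub_distrib, mul_sub] at e1 e2
  rw [integral_sub (hint f) (hint g)] at e2
  simp only [ContinuousMap.neg_apply, Finset.sum_neg_distrib, integral_neg, mul_neg] at l2
  rw [Real.dist_eq, abs_lt]
  rw [abs_le] at e1 e2
  constructor <;> linarith

/-! ### Evenly spaced points -/

theorem circlePoint_periodic (b : OrthonormalBasis (Fin 3) ℝ E3) (r : ℝ) :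
    Function.Periodic (circlePoint b r) (2 * Real.pi) := by
  intro θ
  apply Subtype.ext
  simp [circlePoint]

theorem dist_circlePoint_le (b : OrthonormalBasis (Fin 3) ℝ E3) (r θ θ' : ℝ) :
    dist (circlePoint b r θ) (circlePoint b r θ') ≤ 2 * |θ - θ'| := by
  have h : (circlePoint b r θ : E3) - circlePoint b r θ' =
      Real.sin r • ((Real.cos θ - Real.cos θ') • b 1 + (Real.sin θ - Real.sin θ') • b 2) := by
    simp only [circlePoint, sub_smul, smul_sub, smul_add]
    abel
  rw [Subtype.dist_eq, dist_eq_norm, h, norm_smul]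
  have h1 : ‖(Real.cos θ - Real.cos θ') • b 1 + (Real.sin θ - Real.sin θ') • b 2‖ ≤
      2 * |θ - θ'| := by
    refine (norm_add_le _ _).trans ?_
    rw [norm_smul, norm_smul, b.orthonormal.1, b.orthonormal.1, mul_one, mul_one,
      Real.norm_eq_abs, Real.norm_eq_abs, two_mul]
    exact add_le_add (Real.abs_cos_sub_cos_le _ _) (Real.abs_sin_sub_sin_le _ _)
  calc _ ≤ 1 * (2 * |θ - θ'|) :=
        mul_le_mul (by simpa using Real.abs_sin_le_one r) h1 (norm_nonneg _) zero_le_one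
    _ = _ := one_mul _

/-- Two parametrizations of the same circle differ by a rotation or a reflection. -/
theorem circlePoint_change_basis {b b' : OrthonormalBasis (Fin 3) ℝ E3} (h : b 0 = b' 0) (r : ℝ) :
    ∃ α : ℝ, (∀ θ, circlePoint b' r θ = circlePoint b r (α + θ)) ∨
      ∀ θ, circlePoint b' r θ = circlePoint b r (α - θ) := by
  have hexp : ∀ i : Fin 3, i ≠ 0 →
      b' i = inner ℝ (b 1) (b' i) • b 1 + inner ℝ (b 2) (b' i) • b 2 := by
    intro i hi
    have h0 : inner ℝ (b 0) (b' i) = (0 : ℝ) := by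
      rw [h]
      exact b'.orthonormal.2 hi.symm
    conv_lhs => rw [← b.sum_repr' (b' i), Fin.sum_univ_three, h0]
    simp
  have e1 := hexp 1 (by decide)
  have e2 := hexp 2 (by decide)
  set x := inner ℝ (b 1) (b' 1)
  set y := inner ℝ (b 2) (b' 1)
  set z := inner ℝ (b 1) (b' 2)
  set w := inner ℝ (b 2) (b' 2)
  have b11 : inner ℝ (b 1) (b 1) = (1 : ℝ) := by simp
  have b22 : inner ℝ (b 2) (b 2) = (1 : ℝ) := by simp
  have b12 : inner ℝ (b 1) (b 2) = (0 : ℝ) := b.orthonormal.2 (by decide)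
  have b21 : inner ℝ (b 2) (b 1) = (0 : ℝ) := b.orthonormal.2 (by decide)
  have n1 : x ^ 2 + y ^ 2 = 1 := by
    have : inner ℝ (b' 1) (b' 1) = (1 : ℝ) := by simp
    rw [e1] at this
    simp only [inner_add_left, inner_add_right, real_inner_smul_left, real_inner_smul_right,
      b11, b22, b12, b21] at this
    linarith
  have n2 : z ^ 2 + w ^ 2 = 1 := by
    have : inner ℝ (b' 2) (b' 2) = (1 : ℝ) := by simp
    rw [e2] at this
    simp only [inner_add_left, inner_add_right, real_inner_smul_left, real_inner_smul_right,
      b11, b22, b12, b21] at this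
    linarith
  have n3 : x * z + y * w = 0 := by
    have : inner ℝ (b' 1) (b' 2) = (0 : ℝ) := b'.orthonormal.2 (by decide)
    rw [e1, e2] at this
    simp only [inner_add_left, inner_add_right, real_inner_smul_left, real_inner_smul_right,
      b11, b22, b12, b21] at this
    linarith
  obtain ⟨α, hx, hy⟩ : ∃ α : ℝ, Real.cos α = x ∧ Real.sin α = y := by
    have hn : ‖(⟨x, y⟩ : ℂ)‖ = 1 := by
      rw [Complex.norm_eq_sqrt_sq_add_sq, n1, Real.sqrt_one]
    have hc : (⟨x, y⟩ : ℂ) ≠ 0 := by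
      intro h0
      simp [h0] at hn
    exact ⟨Complex.arg ⟨x, y⟩, by rw [Complex.cos_arg hc, hn, div_one],
      by rw [Complex.sin_arg, hn, div_one]⟩
  -- Lagrange's identity: the change of basis in the plane of the circle is orthogonal. Determinant
  -- `1` gives a rotation, `-1` a reflection.
  have hdet : (x * w - y * z) ^ 2 = 1 := by
    linear_combination n2 * (x ^ 2 + y ^ 2) + n1 - n3 * (x * z + y * w)
  refine ⟨α, (sq_eq_one_iff.1 hdet).imp (fun hd θ => ?_) fun hd θ => ?_⟩
  · have hz : z = -y := by linear_combination x * n3 - z * n1 - y * hd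
    have hw : w = x := by linear_combination y * n3 - w * n1 + x * hd
    apply Subtype.ext
    simp only [circlePoint]
    rw [e1, e2, ← h, hz, hw, Real.cos_add, Real.sin_add, hx, hy]
    module
  · have hz : z = y := by linear_combination x * n3 - z * n1 - y * hd
    have hw : w = -x := by linear_combination y * n3 - w * n1 + x * hd
    apply Subtype.ext
    simp only [circlePoint]
    rw [e1, e2, ← h, hz, hw, Real.cos_sub, Real.sin_sub, hx, hy]
    module

/-- An integral over a full period is invariant under shifts and reflections of the angle. This
reconciles the basis chosen in `circleUniform` with those of the evenly spaced families. -/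
theorem integral_circlePoint_eq {b b' : OrthonormalBasis (Fin 3) ℝ E3} (h : b 0 = b' 0) (r : ℝ)
    (f : S2 → ℝ) : ∫ θ in 0..2 * Real.pi, f (circlePoint b' r θ) =
      ∫ θ in 0..2 * Real.pi, f (circlePoint b r θ) := by
  have hper : Function.Periodic (fun θ => f (circlePoint b r θ)) (2 * Real.pi) :=
    fun θ => by simp only [circlePoint_periodic b r θ]
  obtain ⟨α, hα | hα⟩ := circlePoint_change_basis h r
  · simp only [hα]
    rw [intervalIntegral.integral_comp_add_left (fun θ => f (circlePoint b r θ)), add_zero,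
      hper.intervalIntegral_add_eq α 0, zero_add]
  · simp only [hα]
    rw [intervalIntegral.integral_comp_sub_left (fun θ => f (circlePoint b r θ)), sub_zero]
    have := hper.intervalIntegral_add_eq (α - 2 * Real.pi) 0
    rwa [sub_add_cancel, zero_add] at this

theorem integral_circleUniform {c : S2} {b : OrthonormalBasis (Fin 3) ℝ E3} (hb : b 0 = (c : E3))
    (r : ℝ) (f : C(S2, ℝ)) : ∫ x, f x ∂circleUniform c r =
      (2 * Real.pi)⁻¹ * ∫ θ in 0..2 * Real.pi, f (circlePoint b r θ) := by
  have hc := (exists_basis_center c).choose_spec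
  rw [circleUniform, integral_map (continuous_circlePoint _ r).aemeasurable
    f.continuous.aestronglyMeasurable, ProbabilityTheory.cond, integral_smul_measure,
    ← intervalIntegral.integral_of_le (by positivity),
    integral_circlePoint_eq (hb.trans hc.symm)]
  simp [Real.volume_Ioc, Real.pi_pos.le]

/-- The average of a function over evenly spaced points is close to its mean value. -/
theorem abs_average_sub_integral_le {g : ℝ → ℝ} (hg : Continuous g) {n : ℕ} (hn : 0 < n) {ε : ℝ}
    (h : ∀ θ θ', |θ - θ'| ≤ 2 * Real.pi / n → |g θ - g θ'| ≤ ε) :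
    |(n : ℝ)⁻¹ * ∑ j : Fin n, g (2 * Real.pi * j / n) -
      (2 * Real.pi)⁻¹ * ∫ θ in 0..2 * Real.pi, g θ| ≤ ε := by
  have hn' : (0 : ℝ) < n := Nat.cast_pos.2 hn
  have hπ := Real.pi_pos
  have hsum : ∫ θ in 0..2 * Real.pi, g θ = ∑ j ∈ Finset.range n,
      ∫ θ in (2 * Real.pi * (j : ℕ) / n)..(2 * Real.pi * ((j + 1 : ℕ) : ℝ) / n), g θ := by
    rw [intervalIntegral.sum_integral_adjacent_intervals
      (a := fun j : ℕ => 2 * Real.pi * (j : ℝ) / n) fun j _ => hg.intervalIntegrable _ _]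
    congr 1
    · simp
    · field_simp
  -- Each sample value is compared with the integral over the interval of length `2π / n` that
  -- starts at its sample point.
  have hterm : ∀ j : ℕ, |2 * Real.pi / n * g (2 * Real.pi * j / n) -
      ∫ θ in (2 * Real.pi * (j : ℕ) / n)..(2 * Real.pi * ((j + 1 : ℕ) : ℝ) / n), g θ| ≤
      ε * (2 * Real.pi / n) := by
    intro j
    have hlen : 2 * Real.pi * ((j + 1 : ℕ) : ℝ) / n - 2 * Real.pi * (j : ℕ) / n =
        2 * Real.pi / n := by
      push_cast
      ring
    have hpos : 0 < 2 * Real.pi / n := by positivity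
    have hconst : 2 * Real.pi / n * g (2 * Real.pi * j / n) =
        ∫ _ in (2 * Real.pi * (j : ℕ) / n)..(2 * Real.pi * ((j + 1 : ℕ) : ℝ) / n),
          g (2 * Real.pi * j / n) := by
      rw [intervalIntegral.integral_const, hlen, smul_eq_mul]
    rw [hconst, ← intervalIntegral.integral_sub intervalIntegrable_const
      (hg.intervalIntegrable _ _)]
    have := intervalIntegral.norm_integral_le_of_norm_le_const (C := ε)
      (f := fun θ => g (2 * Real.pi * j / n) - g θ)
      (a := 2 * Real.pi * (j : ℕ) / n) (b := 2 * Real.pi * ((j + 1 : ℕ) : ℝ) / n) ?_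
    · rwa [hlen, abs_of_pos hpos] at this
    · intro θ hθ
      rw [Set.uIoc_of_le (by linarith)] at hθ
      refine h _ _ ?_
      rw [abs_le]
      constructor <;> linarith [hθ.1, hθ.2]
  have key : |2 * Real.pi / n * ∑ j ∈ Finset.range n, g (2 * Real.pi * j / n) -
      ∫ θ in 0..2 * Real.pi, g θ| ≤ 2 * Real.pi * ε := by
    rw [hsum, Finset.mul_sum, ← Finset.sum_sub_distrib]
    refine (Finset.abs_sum_le_sum_abs _ _).trans ((Finset.sum_le_sum fun j _ => hterm j).trans ?_)
    rw [Finset.sum_const, Finset.card_range, nsmul_eq_mul]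
    refine le_of_eq ?_
    field_simp
  rw [Fin.sum_univ_eq_sum_range (fun j : ℕ => g (2 * Real.pi * j / n)) n]
  have hfac : (n : ℝ)⁻¹ * ∑ j ∈ Finset.range n, g (2 * Real.pi * j / n) -
      (2 * Real.pi)⁻¹ * ∫ θ in 0..2 * Real.pi, g θ = (2 * Real.pi)⁻¹ *
      (2 * Real.pi / n * ∑ j ∈ Finset.range n, g (2 * Real.pi * j / n) -
        ∫ θ in 0..2 * Real.pi, g θ) := by
    field_simp
  rw [hfac, abs_mul, abs_of_pos (by positivity), inv_mul_le_iff₀ (by positivity)]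
  exact key

theorem tendsto_average_evenlySpaced {c : S2} {r : ℝ} {p : ∀ n : ℕ, Fin n → S2}
    (hp : ∀ n, EvenlySpaced c r (p n)) (f : C(S2, ℝ)) :
    Tendsto (fun n : ℕ => (n : ℝ)⁻¹ * ∑ j, f (p n j)) atTop
      (𝓝 (∫ x, f x ∂circleUniform c r)) := by
  rw [Metric.tendsto_atTop']
  intro ε hε
  obtain ⟨δ, hδ, hf⟩ := Metric.uniformContinuous_iff.1
    (CompactSpace.uniformContinuous_of_continuous f.continuous) (ε / 2) (by linarith)
  -- `circlePoint` is 2-Lipschitz in the angle, so neighbouring points are within `δ` once `2 * (2π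
  -- / n) < δ`. This threshold is the same for all bases, which may vary with `n`.
  obtain ⟨N, hN⟩ := exists_nat_gt (4 * Real.pi / δ)
  refine ⟨N, fun n hn => ?_⟩
  have hn0 : 0 < n := by omega
  have hn' : (0 : ℝ) < n := Nat.cast_pos.2 hn0
  obtain ⟨b, hb, hpb⟩ := hp n
  rw [Real.dist_eq, integral_circleUniform hb]
  simp only [hpb]
  refine lt_of_le_of_lt (abs_average_sub_integral_le (g := fun θ => f (circlePoint b r θ))
    (f.continuous.comp (continuous_circlePoint b r)) hn0 (ε := ε / 2) fun θ θ' hθ => ?_)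
    (by linarith)
  have hnN : 4 * Real.pi / δ < n := hN.trans (Nat.cast_lt.2 hn)
  rw [div_lt_iff₀ hδ] at hnN
  have : 2 * (2 * Real.pi / n) < δ := by
    rw [← mul_div_assoc, div_lt_iff₀ hn']
    linarith
  exact (hf ((dist_circlePoint_le b r θ θ').trans_lt (by linarith))).le

theorem tendsto_average_fourCircles {c : Fin 4 → S2} {r : ℝ} {A : ∀ n : ℕ, Fin 4 × Fin n → S2}
    (hA : ∀ n q, EvenlySpaced (c q) r fun j => A n (q, j)) (f : C(S2, ℝ)) :
    Tendsto (fun n : ℕ => (Fintype.card (Fin 4 × Fin n) : ℝ)⁻¹ * ∑ i, f (A n i)) atTop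
      (𝓝 (∫ x, f x ∂fourCirclesUniform c r)) := by
  have hint : ∫ x, f x ∂fourCirclesUniform c r =
      (4 : ℝ)⁻¹ * ∑ q, ∫ x, f x ∂circleUniform (c q) r := by
    rw [fourCirclesUniform, integral_smul_measure, integral_finsetSum_measure]
    · simp
    · intro q _
      exact f.continuous.integrable_of_hasCompactSupport
        (HasCompactSupport.of_compactSpace f)
  rw [hint]
  have := (tendsto_finsetSum Finset.univ fun q _ =>
    tendsto_average_evenlySpaced (fun n => hA n q) f).const_mul (4 : ℝ)⁻¹
  refine this.congr fun n => ?_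
  rw [Fintype.sum_prod_type, ← Finset.mul_sum, ← mul_assoc, Fintype.card_prod, Fintype.card_fin,
    Fintype.card_fin, Nat.cast_mul, mul_inv]
  norm_num

end

/-! ### Crossing graphons -/

/-- The density of `H` in the crossing graph of infinitely many random edges. -/
noncomputable def crossingDensity (μ ν : Measure S2) {k : ℕ} (H : SimpleGraph (Fin k)) : ℝ :=
  (Measure.pi fun _ : Fin k => μ.prod ν).real (homSet H properCrossings)

theorem tendsto_homDensity_of_tendsto_average {ι κ : ℕ → Type} [∀ n, Fintype (ι n)]
    [∀ n, Fintype (κ n)] [∀ n, Nonempty (ι (n + 1))] [∀ n, Nonempty (κ (n + 1))]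
    (a : ∀ n, ι n → S2) (b : ∀ n, κ n → S2) {μ ν : Measure S2} [IsProbabilityMeasure μ]
    [IsProbabilityMeasure ν] (hμ : NullOnGreatCircles μ) (hν : NullOnGreatCircles ν)
    (ha : ∀ f : C(S2, ℝ), Tendsto (fun n => (Fintype.card (ι n) : ℝ)⁻¹ * ∑ i, f (a n i)) atTop
      (𝓝 (∫ x, f x ∂μ)))
    (hb : ∀ f : C(S2, ℝ), Tendsto (fun n => (Fintype.card (κ n) : ℝ)⁻¹ * ∑ i, f (b n i)) atTop
      (𝓝 (∫ x, f x ∂ν))) {k : ℕ} (H : SimpleGraph (Fin k)) :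
    Tendsto (fun n => homDensity H (crossingGraph (a n) (b n))) atTop
      (𝓝 (crossingDensity μ ν H)) := by
  -- At `n = 0` the parts may be empty and have no empirical probability measure; the shift skips
  -- this term.
  refine (tendsto_add_atTop_iff_nat 1).1 ?_
  exact tendsto_homDensity_crossingGraph (fun n => a (n + 1)) (fun n => b (n + 1))
    ⟨μ, inferInstance⟩ ⟨ν, inferInstance⟩ hμ hν
    (tendsto_empiricalProb _ _ fun f => (ha f).comp (tendsto_add_atTop_nat 1))
    (tendsto_empiricalProb _ _ fun f => (hb f).comp (tendsto_add_atTop_nat 1)) H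

theorem ae_tendsto_homDensity {Ω : Type} [MeasurableSpace Ω] {P : Measure Ω}
    {μ ν : Measure S2} [IsProbabilityMeasure μ] [IsProbabilityMeasure ν]
    (hμ : NullOnGreatCircles μ) (hν : NullOnGreatCircles ν) {A B : ∀ n : ℕ, Ω → Fin n → S2}
    (h : ∀ n, ProbabilityTheory.HasLaw (fun ω => (A n ω, B n ω))
      ((Measure.pi fun _ => μ).prod (Measure.pi fun _ => ν)) P) :
    ∀ᵐ ω ∂P, ∀ (k : ℕ) (H : SimpleGraph (Fin k)),
      Tendsto (fun n => homDensity H (crossingGraph (A n ω) (B n ω))) atTop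
        (𝓝 (crossingDensity μ ν H)) := by
  have hA : ∀ n, ProbabilityTheory.HasLaw (A n) (Measure.pi fun _ => μ) P := fun n =>
    ⟨(h n).aemeasurable.fst, by
      rw [show A n = Prod.fst ∘ fun ω => (A n ω, B n ω) from rfl,
        ← AEMeasurable.map_map_of_aemeasurable measurable_fst.aemeasurable (h n).aemeasurable,
        (h n).map_eq, Measure.map_fst_prod]
      simp⟩
  have hB : ∀ n, ProbabilityTheory.HasLaw (B n) (Measure.pi fun _ => ν) P := fun n =>
    ⟨(h n).aemeasurable.snd, by
      rw [show B n = Prod.snd ∘ fun ω => (A n ω, B n ω) from rfl,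
        ← AEMeasurable.map_map_of_aemeasurable measurable_snd.aemeasurable (h n).aemeasurable,
        (h n).map_eq, Measure.map_snd_prod]
      simp⟩
  filter_upwards [ae_tendsto_average hA, ae_tendsto_average hB] with ω hωA hωB k H
  exact tendsto_homDensity_of_tendsto_average (fun n => A n ω) (fun n => B n ω) hμ hν
    (by simpa only [Fintype.card_fin] using hωA) (by simpa only [Fintype.card_fin] using hωB) H

theorem exists_isCrossingGraphon {μ ν : Measure S2} [IsProbabilityMeasure μ]
    [IsProbabilityMeasure ν] (hμ : NullOnGreatCircles μ) (hν : NullOnGreatCircles ν) :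
    ∃ W : Graphon, IsCrossingGraphon μ ν W := by
  obtain ⟨W, hW⟩ := exists_graphon_homDensity_eq (μ.prod ν)
  refine ⟨W, fun Ω _ P _ A B h => ?_⟩
  filter_upwards [ae_tendsto_homDensity hμ hν h] with ω hω k H
  rw [hW]
  exact hω k H

/-- The homomorphism densities of a crossing graphon are determined by the two measures. -/
theorem IsCrossingGraphon.homDensity_eq {μ ν : Measure S2} [IsProbabilityMeasure μ]
    [IsProbabilityMeasure ν] (hμ : NullOnGreatCircles μ) (hν : NullOnGreatCircles ν) {W : Graphon}
    (hW : IsCrossingGraphon μ ν W) {k : ℕ} (H : SimpleGraph (Fin k)) :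
    W.homDensity H = crossingDensity μ ν H := by
  -- One concrete probability space carrying drawings of all sizes, here independent. Two almost
  -- sure events share an outcome `ω`, at which both limits are attained by the same sequence.
  let P := Measure.infinitePi fun n : ℕ =>
    (Measure.pi fun _ : Fin n => μ).prod (Measure.pi fun _ : Fin n => ν)
  have h : ∀ n, ProbabilityTheory.HasLaw
      (fun ω : ∀ n : ℕ, (Fin n → S2) × (Fin n → S2) => ((ω n).1, (ω n).2))
      ((Measure.pi fun _ => μ).prod (Measure.pi fun _ => ν)) P := fun n =>
    ⟨(measurable_pi_apply n).aemeasurable, Measure.infinitePi_map_eval _ n⟩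
  obtain ⟨ω, h1, h2⟩ := ((hW _ P (fun n ω => (ω n).1) (fun n ω => (ω n).2) h).and
    (ae_tendsto_homDensity hμ hν (A := fun n ω => (ω n).1) (B := fun n ω => (ω n).2) h)).exists
  exact tendsto_nhds_unique (h1 k H) (h2 k H)

theorem theorem5 (r : ℝ) (hr₀ : 0 < r) (hr : r < Real.pi / 2) (v₁ v₂ w₁ w₂ : S2)
    (hD : Function.Injective (Sum.elim (antipodalPairs v₁ v₂) (antipodalPairs w₁ w₂))) :
    (∃ W : Graphon, IsCrossingGraphon (fourCirclesUniform (antipodalPairs v₁ v₂) r)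
      (fourCirclesUniform (antipodalPairs w₁ w₂) r) W) ∧
    ∀ W : Graphon, IsCrossingGraphon (fourCirclesUniform (antipodalPairs v₁ v₂) r)
        (fourCirclesUniform (antipodalPairs w₁ w₂) r) W →
      ∀ A B : ∀ n : ℕ, Fin 4 × Fin n → S2,
        (∀ n, IsBlowup n (antipodalPairs v₁ v₂) (antipodalPairs w₁ w₂) r (A n) (B n)) →
        ConvergesToGraphon (fun n => crossingGraph (A n) (B n)) W := by
  have hμ := nullOnGreatCircles_fourCirclesUniform (antipodalPairs v₁ v₂) hr₀ hr
  have hν := nullOnGreatCircles_fourCirclesUniform (antipodalPairs w₁ w₂) hr₀ hr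
  refine ⟨exists_isCrossingGraphon hμ hν, fun W hW A B hAB k H => ?_⟩
  rw [hW.homDensity_eq hμ hν]
  exact tendsto_homDensity_of_tendsto_average A B hμ hν
    (tendsto_average_fourCircles fun n => (hAB n).left)
    (tendsto_average_fourCircles fun n => (hAB n).right) H
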